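/- Let $n,k,r,s$ be integers with $k\ge 1$, $r\ge 2$, $s\ge 1$, and let $S=(s_1,\dots,s_n)$ with $s_1=\dots=s_n=s$. Let $\mathrm{KG}^r_S(n,k)$ be the $r$-uniform hypergraph whose vertices are the $k$-element subsets of $[n]=\{1,\dots,n\}$ and whose edges are the multisets $\{A_1,\dots,A_r\}$ of $k$-subsets (repetitions allowed) that are $S$-disjoint, i.e. such that for every $1\le i\le n$ the number of indices $1\le j\le r$ with $i\in A_j$ is at most $s_i$. Its chromatic number $\chi(\mathrm{KG}^r_S(n,k))$ is the least number of colors in a coloring of the vertices for which no edge is monochromatic (and infinity if there is no such coloring). If $s$ divides $r-1$ and $ns\ge rk$, then $$\chi(\mathrm{KG}^r_S(n,k))=\left\lceil\frac{ns-r(k-1)}{r-1}\right\rceil .$$ -/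

import Mathlib

/-- A hypergraph on the vertex set `V` whose edges are multisets of vertices (so a vertex may be
repeated inside an edge). -/
structure MultisetHypergraph (V : Type*) where
  /-- The set of edges. -/
  edges : Set (Multiset V)

namespace MultisetHypergraph

variable {V : Type*}

/-- A coloring is proper if no edge is monochromatic: every edge contains two vertices of
different colors. In particular, a hypergraph with a loop `{v, …, v}` has no proper coloring. -/
def IsProperColoring (H : MultisetHypergraph V) {α : Type*} (c : V → α) : Prop :=
  ∀ e ∈ H.edges, ∃ v ∈ e, ∃ w ∈ e, c v ≠ c w

/-- `H` has a proper coloring with `m` colors. -/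
def Colorable (H : MultisetHypergraph V) (m : ℕ) : Prop :=
  ∃ c : V → Fin m, H.IsProperColoring c

/-- The least number of colors of a proper coloring; it is `⊤` (infinity) if there is no proper
coloring with finitely many colors. -/
noncomputable def chromaticNumber (H : MultisetHypergraph V) : ℕ∞ :=
  ⨅ m ∈ {m : ℕ | H.Colorable m}, (m : ℕ∞)

end MultisetHypergraph

/-- The `k`-element subsets of the `n`-element set `Fin n`. -/
abbrev KSubset (n k : ℕ) : Type := {A : Finset (Fin n) // A.card = k}

/-- A multiset `{A₁, …, A_r}` of `k`-subsets is `S`-disjoint if every `i` lies in at most `S i` of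
the sets `A_j`, counted with multiplicity. -/
def IsSDisjoint {n k : ℕ} (S : Fin n → ℕ) (e : Multiset (KSubset n k)) : Prop :=
  ∀ i : Fin n, e.countP (fun A => i ∈ A.1) ≤ S i

/-- The `r`-uniform Kneser hypergraph `KG^r_S(n,k)`: the vertices are the `k`-subsets of an
`n`-element set, the edges are the `S`-disjoint multisets of `r` vertices. -/
def kneserHypergraph (r n k : ℕ) (S : Fin n → ℕ) : MultisetHypergraph (KSubset n k) where
  edges := {e | e.card = r ∧ IsSDisjoint S e}

/-! ### Chains of ordered simplices and the `ℤ/p`-Tucker lemma -/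

namespace ZpTucker

open Finsupp

/-! Upper bound (`colorable_of_lt`): with `q = (r - 1) / s`, colour a set by the block of `q`
consecutive elements containing its minimum, and merge all late blocks into one last colour. A block
has only `q * s = r - 1` incidences with an edge, and the last colour lives on too few elements for
`r` sets of size `k`.

Lower bound (`forcesMonochromatic`): for arbitrary multiplicities `S i ≤ r` the claim is
multiplicative in `r` (`ForcesMonochromatic.mul`), so prime `r = p` is the main case. Replace `i` by
`S i` copies; a partial assignment of signs in `ℤ/p` to the copies is a simplex of a join of copies
of `ℤ/p`. Without a monochromatic edge, the signed sets and the colours they capture yield an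
equivariant labelling with too few levels, against the Tucker lemma `IsLabelling.le`.

That lemma is proved with chains modulo `p`. A labelling induces an equivariant chain map, which
preserves the relations between the chains of the minimal resolution. With too few levels the top
image vanishes; exactness carries this down to degree 0, where an augmentation equal to 1 would have
to vanish modulo `p`. -/

/-- Formal combinations with coefficients in `ZMod p` of lists of vertices; a vertex consists of a
level and a sign. -/
abbrev Chains (p : ℕ) : Type := List (ℕ × ZMod p) →₀ ZMod p

variable {p : ℕ}

/-- The linear map with prescribed values on lists. -/
noncomputable def extend (f : List (ℕ × ZMod p) → Chains p) : Chains p →ₗ[ZMod p] Chains p :=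
  Finsupp.linearCombination (ZMod p) f

@[simp] lemma extend_single (f : List (ℕ × ZMod p) → Chains p) (l : List (ℕ × ZMod p)) :
    extend f (single l 1) = f l := by
  simp [extend]

lemma chains_hom_ext {f g : Chains p →ₗ[ZMod p] Chains p}
    (h : ∀ l, f (single l 1) = g (single l 1)) : f = g := by
  refine Finsupp.lhom_ext' fun l => LinearMap.ext_ring ?_
  simpa using h l

/-- The chains supported on the lists satisfying `P`. -/
abbrev chainsOn (P : List (ℕ × ZMod p) → Prop) : Submodule (ZMod p) (Chains p) :=
  Finsupp.supported (ZMod p) (ZMod p) {l | P l}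

lemma single_mem_chainsOn {P : List (ℕ × ZMod p) → Prop} {l : List (ℕ × ZMod p)} (h : P l) :
    (single l 1 : Chains p) ∈ chainsOn P :=
  Finsupp.single_mem_supported _ _ h

lemma chainsOn_mono {P Q : List (ℕ × ZMod p) → Prop} (h : ∀ l, P l → Q l) :
    chainsOn P ≤ chainsOn Q :=
  Finsupp.supported_mono h

lemma chainsOn_induction {P : List (ℕ × ZMod p) → Prop} {Q : Submodule (ZMod p) (Chains p)}
    (h : ∀ l, P l → (single l 1 : Chains p) ∈ Q) : chainsOn P ≤ Q := by
  rw [chainsOn, Finsupp.supported_eq_span_single, Submodule.span_le]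
  rintro _ ⟨l, hl, rfl⟩
  exact h l hl

lemma map_mem_of_chainsOn {P : List (ℕ × ZMod p) → Prop} {Q : Submodule (ZMod p) (Chains p)}
    {f : Chains p →ₗ[ZMod p] Chains p} (h : ∀ l, P l → f (single l 1) ∈ Q) {z : Chains p}
    (hz : z ∈ chainsOn P) : f z ∈ Q :=
  chainsOn_induction (Q := Q.comap f) h hz

lemma eqOn_chainsOn {P : List (ℕ × ZMod p) → Prop} {f g : Chains p →ₗ[ZMod p] Chains p}
    (h : ∀ l, P l → f (single l 1) = g (single l 1)) {z : Chains p} (hz : z ∈ chainsOn P) :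
    f z = g z :=
  chainsOn_induction (Q := LinearMap.eqLocus f g) h hz

/-! ### Augmented boundary and the sign action -/

/-- Adding a vertex in front. -/
noncomputable def prepend (v : ℕ × ZMod p) : Chains p →ₗ[ZMod p] Chains p :=
  extend fun l => single (v :: l) 1

@[simp] lemma prepend_single (v : ℕ × ZMod p) (l : List (ℕ × ZMod p)) :
    prepend v (single l 1) = single (v :: l) 1 := by
  simp [prepend]

/-- The boundary of a single list. -/
noncomputable def boundaryList : List (ℕ × ZMod p) → Chains p
  | [] => 0
  | v :: l => single l 1 - prepend v (boundaryList l)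

/-- The boundary operator. -/
noncomputable def boundary : Chains p →ₗ[ZMod p] Chains p := extend boundaryList

@[simp] lemma boundary_single_nil : boundary (single [] 1 : Chains p) = 0 := by
  simp [boundary, boundaryList]

@[simp] lemma boundary_single_cons (v : ℕ × ZMod p) (l : List (ℕ × ZMod p)) :
    boundary (single (v :: l) 1) = single l 1 - prepend v (boundary (single l 1)) := by
  simp [boundary, boundaryList]

lemma boundary_prepend (v : ℕ × ZMod p) (z : Chains p) :
    boundary (prepend v z) = z - prepend v (boundary z) := by
  have : boundary ∘ₗ prepend v = LinearMap.id - prepend v ∘ₗ boundary :=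
    chains_hom_ext fun l => by simp
  simpa using LinearMap.congr_fun this z

lemma boundary_boundary (z : Chains p) : boundary (boundary z) = 0 := by
  have : boundary ∘ₗ boundary = (0 : Chains p →ₗ[ZMod p] Chains p) :=
    chains_hom_ext fun l => by
      induction l with
      | nil => simp
      | cons v l ih =>
        simp only [LinearMap.comp_apply, LinearMap.zero_apply] at ih
        simp [boundary_prepend, ih]
  simpa using LinearMap.congr_fun this z

lemma boundary_single_mem (l : List (ℕ × ZMod p)) :
    boundary (single l 1) ∈ chainsOn fun l' => l'.Sublist l ∧ l'.length + 1 = l.length := by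
  induction l with
  | nil => simp
  | cons v l ih =>
    rw [boundary_single_cons]
    refine Submodule.sub_mem _ (single_mem_chainsOn ⟨List.sublist_cons_self v l, by simp⟩) ?_
    refine map_mem_of_chainsOn (fun l' hl' => ?_) ih
    rw [prepend_single]
    exact single_mem_chainsOn ⟨hl'.1.cons_cons v, by simp [hl'.2]⟩

lemma boundary_mem_length {n : ℕ} {z : Chains p} (hz : z ∈ chainsOn fun l => l.length = n + 1) :
    boundary z ∈ chainsOn fun l => l.length = n :=
  map_mem_of_chainsOn (fun l hl => chainsOn_mono (fun l' h => by have := h.2; omega)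
    (boundary_single_mem l)) hz

/-- The action of `ZMod p` on chains by translating all signs. -/
noncomputable def shift (g : ZMod p) : Chains p →ₗ[ZMod p] Chains p :=
  extend fun l => single (l.map fun v => (v.1, v.2 + g)) 1

@[simp] lemma shift_single (g : ZMod p) (l : List (ℕ × ZMod p)) :
    shift g (single l 1) = single (l.map fun v => (v.1, v.2 + g)) 1 := by
  simp [shift]

lemma shift_shift (g h : ZMod p) (z : Chains p) : shift g (shift h z) = shift (h + g) z := by
  have : shift g ∘ₗ shift h = shift (h + g) :=
    chains_hom_ext fun l => by simp [Function.comp_def, add_assoc]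
  simpa using LinearMap.congr_fun this z

lemma shift_zero (z : Chains p) : shift 0 z = z := by
  have : shift (0 : ZMod p) = LinearMap.id := chains_hom_ext fun l => by simp
  simpa using LinearMap.congr_fun this z

lemma shift_prepend (g : ZMod p) (v : ℕ × ZMod p) (z : Chains p) :
    shift g (prepend v z) = prepend (v.1, v.2 + g) (shift g z) := by
  have : shift g ∘ₗ prepend v = prepend (v.1, v.2 + g) ∘ₗ shift g :=
    chains_hom_ext fun l => by simp
  simpa using LinearMap.congr_fun this z

lemma boundary_shift (g : ZMod p) (z : Chains p) :
    boundary (shift g z) = shift g (boundary z) := by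
  have : boundary ∘ₗ shift g = shift g ∘ₗ boundary :=
    chains_hom_ext fun l => by
      induction l with
      | nil => simp
      | cons v l ih =>
        simp only [LinearMap.comp_apply, shift_single] at ih
        simp [ih, shift_prepend]
  simpa using LinearMap.congr_fun this z

lemma shift_mem_length {n : ℕ} (g : ZMod p) {z : Chains p}
    (hz : z ∈ chainsOn fun l => l.length = n) : shift g z ∈ chainsOn fun l => l.length = n :=
  map_mem_of_chainsOn (fun l hl => by
    rw [shift_single]; exact single_mem_chainsOn (by simpa using hl)) hz

/-! ### Simplices of the join and cones -/

/-- Lists with strictly decreasing levels below `N`. -/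
def IsSimplex (N : ℕ) (l : List (ℕ × ZMod p)) : Prop :=
  l.Pairwise (fun v w => w.1 < v.1) ∧ ∀ v ∈ l, v.1 < N

lemma IsSimplex.sublist {N : ℕ} {l l' : List (ℕ × ZMod p)} (h : IsSimplex N l)
    (hl : l'.Sublist l) : IsSimplex N l' :=
  ⟨h.1.sublist hl, fun v hv => h.2 v (hl.subset hv)⟩

lemma IsSimplex.map {N : ℕ} {l : List (ℕ × ZMod p)} (h : IsSimplex N l) (g : ZMod p) :
    IsSimplex N (l.map fun v => (v.1, v.2 + g)) := by
  refine ⟨List.pairwise_map.2 h.1, fun v hv => ?_⟩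
  obtain ⟨w, hw, rfl⟩ := List.mem_map.1 hv
  exact h.2 w hw

lemma IsSimplex.nodup {N : ℕ} {l : List (ℕ × ZMod p)} (h : IsSimplex N l) :
    (l.map Prod.fst).Nodup :=
  List.pairwise_map.2 (h.1.imp fun {_ _} hab => hab.ne')

lemma IsSimplex.length_le {N : ℕ} {l : List (ℕ × ZMod p)} (h : IsSimplex N l) : l.length ≤ N := by
  have h2 : l.map Prod.fst ⊆ List.range N := fun x hx => by
    obtain ⟨w, hw, rfl⟩ := List.mem_map.1 hx
    exact List.mem_range.2 (h.2 w hw)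
  simpa using (h.nodup.subperm h2).length_le

/-- The cone with apex `v`; lists that start with `v` are sent to `0`. -/
noncomputable def cone (v : ℕ × ZMod p) : Chains p →ₗ[ZMod p] Chains p :=
  extend fun l => if l.head? = some v then 0 else single (v :: l) 1

lemma cone_prepend_self (v : ℕ × ZMod p) (z : Chains p) : cone v (prepend v z) = 0 := by
  have : cone v ∘ₗ prepend v = 0 := chains_hom_ext fun l => by simp [cone]
  simpa using LinearMap.congr_fun this z

lemma cone_prepend_of_ne {v w : ℕ × ZMod p} (h : w ≠ v) (z : Chains p) :
    cone v (prepend w z) = prepend v (prepend w z) := by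
  have : cone v ∘ₗ prepend w = prepend v ∘ₗ prepend w :=
    chains_hom_ext fun l => by simp [cone, h]
  simpa using LinearMap.congr_fun this z

lemma shift_cone (g : ZMod p) (v : ℕ × ZMod p) (z : Chains p) :
    shift g (cone v z) = cone (v.1, v.2 + g) (shift g z) := by
  have : shift g ∘ₗ cone v = cone (v.1, v.2 + g) ∘ₗ shift g :=
    chains_hom_ext fun l => by
      cases l with
      | nil => simp [cone]
      | cons w l =>
        have : ((w.1, w.2 + g) = (v.1, v.2 + g)) ↔ w = v := by simp [Prod.ext_iff]
        by_cases hw : w = v <;> simp [cone, hw, this]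
  simpa using LinearMap.congr_fun this z

/-- Lists with strictly decreasing levels that lie below `v` and contain no other vertex on the
level of `v`. -/
def IsBelow (v : ℕ × ZMod p) (l : List (ℕ × ZMod p)) : Prop :=
  l.Pairwise (fun v w => w.1 < v.1) ∧ ∀ w ∈ l, w.1 < v.1 ∨ w = v

lemma IsBelow.nil (v : ℕ × ZMod p) : IsBelow v [] := by simp [IsBelow]

lemma IsBelow.trans {v w : ℕ × ZMod p} {l : List (ℕ × ZMod p)} (h : IsBelow v l)
    (hv : v.1 < w.1 ∨ v = w) : IsBelow w l := by
  rcases hv with hv | rfl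
  · refine ⟨h.1, fun u hu => Or.inl ?_⟩
    rcases h.2 u hu with h' | rfl
    · exact h'.trans hv
    · exact hv
  · exact h

lemma IsBelow.isSimplex {M : ℕ} {v : ℕ × ZMod p} {l : List (ℕ × ZMod p)} (h : IsBelow v l)
    (hv : v.1 < M) : IsSimplex M l := by
  refine ⟨h.1, fun u hu => ?_⟩
  rcases h.2 u hu with h' | rfl
  · exact h'.trans hv
  · exact hv

lemma IsBelow.lt_of_head?_ne {v : ℕ × ZMod p} {l : List (ℕ × ZMod p)} (h : IsBelow v l)
    (hv : l.head? ≠ some v) : ∀ w ∈ l, w.1 < v.1 := by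
  intro w hw
  rcases h.2 w hw with h' | rfl
  · exact h'
  · cases l with
    | nil => simp at hw
    | cons u l =>
      have hu : w ≠ u := fun e => hv (by simp [e])
      have h1 := (List.pairwise_cons.1 h.1).1 w ((List.mem_cons.1 hw).resolve_left hu)
      rcases h.2 u List.mem_cons_self with h2 | h2
      · exact absurd h1 h2.not_gt
      · exact absurd h2.symm hu

lemma cone_mem_isBelow (v : ℕ × ZMod p) {z : Chains p} (hz : z ∈ chainsOn (IsBelow v)) :
    cone v z ∈ chainsOn (IsBelow v) := by
  refine map_mem_of_chainsOn (fun l hl => ?_) hz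
  simp only [cone, extend_single]
  split_ifs with h
  · exact Submodule.zero_mem _
  · refine single_mem_chainsOn ⟨List.pairwise_cons.2 ⟨hl.lt_of_head?_ne h, hl.1⟩, ?_⟩
    intro w hw
    rcases List.mem_cons.1 hw with rfl | hw
    · exact Or.inr rfl
    · exact hl.2 w hw

lemma cone_mem_length (v : ℕ × ZMod p) {n : ℕ} {z : Chains p}
    (hz : z ∈ chainsOn fun l => l.length = n) : cone v z ∈ chainsOn fun l => l.length = n + 1 := by
  refine map_mem_of_chainsOn (fun l hl => ?_) hz
  simp only [cone, extend_single]
  split_ifs with h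
  · exact Submodule.zero_mem _
  · exact single_mem_chainsOn (by simp [hl])

/-- Under `IsBelow` the apex can occur only as first vertex. If it does, the cone is degenerate, and
coning the boundary restores the list from its tail and kills the other terms, so both sides vanish.
-/
lemma boundary_cone (v : ℕ × ZMod p) {z : Chains p} (hz : z ∈ chainsOn (IsBelow v)) :
    boundary (cone v z) = z - cone v (boundary z) := by
  refine eqOn_chainsOn (f := boundary ∘ₗ cone v) (g := LinearMap.id - cone v ∘ₗ boundary)
    (fun l hl => ?_) hz
  cases l with
  | nil => simp [cone]
  | cons w l =>
    have hwl := (List.pairwise_cons.1 hl.1).1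
    by_cases hw : w = v
    · subst hw
      have hl' : l.head? ≠ some w := fun h =>
        lt_irrefl w.1 (hwl w (List.mem_of_mem_head? h))
      have h1 : cone w (single (w :: l) 1) = 0 := by simp [cone]
      have h2 : cone w (single l 1) = single (w :: l) 1 := by simp [cone, hl']
      simp only [LinearMap.comp_apply, LinearMap.sub_apply, LinearMap.id_apply, h1, map_zero,
        boundary_single_cons, map_sub, h2, cone_prepend_self, sub_zero, sub_self]
    · have h1 : cone v (single (w :: l) 1) = single (v :: w :: l) 1 := by simp [cone, hw]
      have hl' : l.head? ≠ some v := fun h => by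
        have h3 := hwl v (List.mem_of_mem_head? h)
        rcases hl.2 w List.mem_cons_self with h4 | h4
        · exact absurd h3 h4.not_gt
        · exact hw h4
      have h2 : cone v (single l 1) = single (v :: l) 1 := by simp [cone, hl']
      simp [h1, h2, cone_prepend_of_ne hw]

/-! ### The chain map of a labelling -/

/-- An equivariant labelling of the simplices of the `N`-fold join of `ZMod p` by levels below `M`
and signs, such that on every level a face of a simplex has the same label as the simplex. -/
structure IsLabelling (N M : ℕ) (lam : List (ℕ × ZMod p) → ℕ × ZMod p) : Prop where
  lt : ∀ a, IsSimplex N a → a ≠ [] → (lam a).1 < M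
  map : ∀ g a, IsSimplex N a → a ≠ [] →
    lam (a.map fun v => (v.1, v.2 + g)) = ((lam a).1, (lam a).2 + g)
  mono : ∀ a b, IsSimplex N b → a ≠ [] → a.Sublist b → (lam a).1 < (lam b).1 ∨ lam a = lam b

/-- The chain map (on chains of lists of length `n`) induced by a labelling of the barycentric
subdivision. -/
noncomputable def labelMap (lam : List (ℕ × ZMod p) → ℕ × ZMod p) :
    ℕ → Chains p →ₗ[ZMod p] Chains p
  | 0 => extend fun _ => single [] 1
  | n + 1 => extend fun a => cone (lam a) (labelMap lam n (boundary (single a 1)))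

lemma labelMap_succ_single (lam : List (ℕ × ZMod p) → ℕ × ZMod p) (n : ℕ)
    (a : List (ℕ × ZMod p)) :
    labelMap lam (n + 1) (single a 1) = cone (lam a) (labelMap lam n (boundary (single a 1))) := by
  simp [labelMap]

lemma labelMap_mem_length (lam : List (ℕ × ZMod p) → ℕ × ZMod p) (n : ℕ) (z : Chains p) :
    labelMap lam n z ∈ chainsOn fun l => l.length = n := by
  have hz : z ∈ chainsOn fun _ => True := by simp [chainsOn]
  induction n generalizing z with
  | zero =>
    refine map_mem_of_chainsOn (fun l _ => ?_) hz
    simp only [labelMap, extend_single]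
    exact single_mem_chainsOn rfl
  | succ n ih =>
    refine map_mem_of_chainsOn (fun l _ => ?_) hz
    rw [labelMap_succ_single]
    exact cone_mem_length _ (ih _ (by simp [chainsOn]))

namespace IsLabelling

variable {N M : ℕ} {lam : List (ℕ × ZMod p) → ℕ × ZMod p}

/-- By `mono`, labels of faces lie below the label of `a` or equal it; this is what makes the cone
formula applicable. -/
lemma labelMap_boundary_mem (h : IsLabelling N M lam) (n : ℕ) {a : List (ℕ × ZMod p)}
    (ha : IsSimplex N a) (hn : a.length = n + 1) :
    labelMap lam n (boundary (single a 1)) ∈ chainsOn (IsBelow (lam a)) := by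
  induction n generalizing a with
  | zero =>
    refine map_mem_of_chainsOn (fun l _ => ?_) (boundary_single_mem a)
    simp only [labelMap, extend_single]
    exact single_mem_chainsOn (IsBelow.nil _)
  | succ n ih =>
    refine map_mem_of_chainsOn (fun l hl => ?_) (boundary_single_mem a)
    have hlen : l.length = n + 1 := by have := hl.2; omega
    rw [labelMap_succ_single]
    refine chainsOn_mono (fun l' hl' => hl'.trans (h.mono l a ha ?_ hl.1))
      (cone_mem_isBelow _ (ih (ha.sublist hl.1) hlen))
    rintro rfl
    simp at hlen

lemma labelMap_single_mem (h : IsLabelling N M lam) (n : ℕ) {a : List (ℕ × ZMod p)}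
    (ha : IsSimplex N a) (hn : a.length = n + 1) :
    labelMap lam (n + 1) (single a 1) ∈ chainsOn (IsSimplex M) := by
  rw [labelMap_succ_single]
  refine chainsOn_mono (fun l hl => hl.isSimplex (h.lt a ha ?_))
    (cone_mem_isBelow _ (h.labelMap_boundary_mem n ha hn))
  rintro rfl
  simp at hn

/-- The error term of the cone formula is the cone over the image of a double boundary, hence zero.
-/
lemma boundary_labelMap_single (h : IsLabelling N M lam) (n : ℕ) {a : List (ℕ × ZMod p)}
    (ha : IsSimplex N a) (hn : a.length = n + 1) :
    boundary (labelMap lam (n + 1) (single a 1)) = labelMap lam n (boundary (single a 1)) := by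
  induction n generalizing a with
  | zero =>
    rw [labelMap_succ_single, boundary_cone _ (h.labelMap_boundary_mem 0 ha hn)]
    have : boundary (labelMap lam 0 (boundary (single a 1))) = 0 :=
      eqOn_chainsOn (f := boundary) (g := 0) (fun l hl => by
        rw [List.length_eq_zero_iff.1 hl]; simp) (labelMap_mem_length lam 0 _)
    rw [this, map_zero, sub_zero]
  | succ n ih =>
    rw [labelMap_succ_single, boundary_cone _ (h.labelMap_boundary_mem (n + 1) ha hn)]
    have : boundary (labelMap lam (n + 1) (boundary (single a 1))) =
        labelMap lam n (boundary (boundary (single a 1))) :=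
      eqOn_chainsOn (f := boundary ∘ₗ labelMap lam (n + 1)) (g := labelMap lam n ∘ₗ boundary)
        (fun l hl => ih (ha.sublist hl.1) (by have := hl.2; omega)) (boundary_single_mem a)
    rw [this, boundary_boundary, map_zero, map_zero, sub_zero]

lemma boundary_labelMap (h : IsLabelling N M lam) (n : ℕ) {z : Chains p}
    (hz : z ∈ chainsOn fun l => l.length = n + 1 ∧ IsSimplex N l) :
    boundary (labelMap lam (n + 1) z) = labelMap lam n (boundary z) :=
  eqOn_chainsOn (f := boundary ∘ₗ labelMap lam (n + 1)) (g := labelMap lam n ∘ₗ boundary)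
    (fun _ hl => h.boundary_labelMap_single n hl.2 hl.1) hz

lemma labelMap_shift (h : IsLabelling N M lam) (n : ℕ) (g : ZMod p) {z : Chains p}
    (hz : z ∈ chainsOn fun l => l.length = n ∧ IsSimplex N l) :
    labelMap lam n (shift g z) = shift g (labelMap lam n z) := by
  induction n generalizing z with
  | zero =>
    refine eqOn_chainsOn (f := labelMap lam 0 ∘ₗ shift g) (g := shift g ∘ₗ labelMap lam 0)
      (fun l hl => ?_) hz
    simp [labelMap]
  | succ n ih =>
    refine eqOn_chainsOn (f := labelMap lam (n + 1) ∘ₗ shift g)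
      (g := shift g ∘ₗ labelMap lam (n + 1)) (fun l hl => ?_) hz
    have hl0 : l ≠ [] := by rintro rfl; simpa using hl.1
    simp only [LinearMap.comp_apply, shift_single, labelMap_succ_single, shift_cone,
      h.map g l hl.2 hl0]
    rw [← shift_single, boundary_shift, ih]
    exact chainsOn_mono (fun l' hl' => ⟨by have := hl'.2; omega, hl.2.sublist hl'.1⟩)
      (boundary_single_mem l)

end IsLabelling

/-! ### Periodic resolution and the Tucker lemma -/

section Prime

variable [Fact p.Prime]

/-- The operators `τ - 1` (even index) and `1 + τ + ⋯ + τ ^ (p - 1)` (odd index), where `τ` is the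
generator of the action on chains. -/
noncomputable def alternatingOp (j : ℕ) : Chains p →ₗ[ZMod p] Chains p :=
  if Even j then shift 1 - LinearMap.id else ∑ g : ZMod p, shift g

lemma alternatingOp_even {j : ℕ} (hj : Even j) (z : Chains p) :
    alternatingOp j z = shift 1 z - z := by
  simp [alternatingOp, hj]

lemma alternatingOp_odd {j : ℕ} (hj : ¬ Even j) (z : Chains p) :
    alternatingOp j z = ∑ g : ZMod p, shift g z := by
  simp [alternatingOp, hj, LinearMap.sum_apply]

lemma alternatingOp_add_two (j : ℕ) : alternatingOp (p := p) (j + 2) = alternatingOp j := by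
  simp [alternatingOp, Nat.even_add]

lemma alternatingOp_mem {P : List (ℕ × ZMod p) → Prop}
    (hP : ∀ (g : ZMod p) (l), P l → P (l.map fun v => (v.1, v.2 + g))) (j : ℕ) {z : Chains p}
    (hz : z ∈ chainsOn P) : alternatingOp j z ∈ chainsOn P := by
  have hs : ∀ g, shift g z ∈ chainsOn P := fun g =>
    map_mem_of_chainsOn (fun l hl => by rw [shift_single]; exact single_mem_chainsOn (hP g l hl)) hz
  by_cases hj : Even j
  · rw [alternatingOp_even hj]; exact Submodule.sub_mem _ (hs 1) hz
  · rw [alternatingOp_odd hj]; exact Submodule.sum_mem _ fun g _ => hs g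

lemma map_alternatingOp {f : Chains p →ₗ[ZMod p] Chains p} {z : Chains p}
    (hf : ∀ g, f (shift g z) = shift g (f z)) (j : ℕ) :
    f (alternatingOp j z) = alternatingOp j (f z) := by
  by_cases hj : Even j
  · simp [alternatingOp_even hj, hf]
  · simp [alternatingOp_odd hj, hf]

lemma sum_shift_shift (g : ZMod p) (z : Chains p) :
    ∑ h : ZMod p, shift h (shift g z) = ∑ h : ZMod p, shift h z := by
  simp_rw [shift_shift]
  exact Fintype.sum_equiv (Equiv.addLeft g) _ _ fun h => rfl

/-- The norm `1 + τ + ⋯ + τ ^ (p - 1)` absorbs translations, so it annihilates `τ - 1` on either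
side. -/
lemma alternatingOp_alternatingOp (j : ℕ) (z : Chains p) :
    alternatingOp (j + 1) (alternatingOp j z) = 0 := by
  by_cases hj : Even j
  · have hj' : ¬ Even (j + 1) := by simpa [Nat.even_add_one] using hj
    rw [alternatingOp_odd hj', alternatingOp_even hj]
    simp only [map_sub, Finset.sum_sub_distrib, sum_shift_shift, sub_self]
  · have hj' : Even (j + 1) := by simpa [Nat.even_add_one] using hj
    rw [alternatingOp_even hj', alternatingOp_odd hj, map_sum, sub_eq_zero]
    simp_rw [shift_shift]
    exact Fintype.sum_equiv (Equiv.addRight 1) _ _ fun h => rfl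

/-- The empty list is fixed by the action, so `τ - 1` kills it and the norm multiplies it by `p =
0`. -/
lemma alternatingOp_nil (j : ℕ) : alternatingOp j (single [] 1 : Chains p) = 0 := by
  by_cases hj : Even j
  · simp [alternatingOp_even hj]
  · simp [alternatingOp_odd hj, ZMod.card]

/-- The restriction of a chain to the lists whose first vertex has sign `g`. -/
noncomputable def headPart (g : ZMod p) : Chains p →ₗ[ZMod p] Chains p :=
  extend fun l => if l.head?.map Prod.snd = some g then single l 1 else 0

lemma headPart_shift (g h : ZMod p) (z : Chains p) :
    shift h (headPart g z) = headPart (g + h) (shift h z) := by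
  have : shift h ∘ₗ headPart g = headPart (g + h) ∘ₗ shift h :=
    chains_hom_ext fun l => by
      cases l with
      | nil => simp [headPart]
      | cons v l => by_cases hv : v.2 = g <;> simp [headPart, hv]
  simpa using LinearMap.congr_fun this z

lemma headPart_mem_length {n : ℕ} (g : ZMod p) {z : Chains p}
    (hz : z ∈ chainsOn fun l => l.length = n) : headPart g z ∈ chainsOn fun l => l.length = n := by
  refine map_mem_of_chainsOn (fun l hl => ?_) hz
  simp only [headPart, extend_single]
  split_ifs
  · exact single_mem_chainsOn hl
  · exact Submodule.zero_mem _

lemma sum_headPart {n : ℕ} {z : Chains p} (hz : z ∈ chainsOn fun l => l.length = n + 1) :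
    ∑ g : ZMod p, headPart g z = z := by
  rw [← LinearMap.sum_apply]
  refine eqOn_chainsOn (g := LinearMap.id) (fun l hl => ?_) hz
  cases l with
  | nil => simp at hl
  | cons v l => simp [headPart, LinearMap.sum_apply]

lemma shift_sub_self_mem {n : ℕ} (g : ZMod p) {z : Chains p}
    (hz : z ∈ chainsOn fun l => l.length = n) :
    shift g z - z ∈ (chainsOn fun l => l.length = n).map (shift (1 : ZMod p) - LinearMap.id) := by
  obtain ⟨m, rfl⟩ := ZMod.natCast_zmod_surjective g
  induction m with
  | zero => simp [shift_zero]
  | succ m ih =>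
    have : shift ((m + 1 : ℕ) : ZMod p) z - z =
        (shift (1 : ZMod p) - LinearMap.id : Chains p →ₗ[ZMod p] Chains p) (shift (m : ZMod p) z) + (shift (m : ZMod p) z - z) := by
      simp [shift_shift, add_comm]
    rw [this]
    exact Submodule.add_mem _ ⟨_, shift_mem_length _ hz, rfl⟩ ih

/-- The complex of chains of positive length is free over the group ring, so that kernels of the
alternating operators are images. -/
lemma exists_alternatingOp_eq {n : ℕ} (j : ℕ) {z : Chains p}
    (hz : z ∈ chainsOn fun l => l.length = n + 1) (h : alternatingOp j z = 0) :
    ∃ w ∈ chainsOn fun l => l.length = n + 1, alternatingOp (j + 1) w = z := by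
  by_cases hj : Even j
  · have hj' : ¬ Even (j + 1) := by simpa [Nat.even_add_one] using hj
    rw [alternatingOp_even hj, sub_eq_zero] at h
    have hfix : ∀ g, shift g z = z := by
      intro g
      obtain ⟨m, rfl⟩ := ZMod.natCast_zmod_surjective g
      induction m with
      | zero => simp [shift_zero]
      | succ m ih => rw [Nat.cast_succ, ← shift_shift, ih, h]
    -- Lists with first sign `0` represent each orbit once, so the norm rebuilds an invariant chain
    -- from this part.
    refine ⟨headPart 0 z, headPart_mem_length 0 hz, ?_⟩
    rw [alternatingOp_odd hj']
    simp only [headPart_shift, zero_add, hfix, sum_headPart hz]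
  · have hj' : Even (j + 1) := by simpa [Nat.even_add_one] using hj
    rw [alternatingOp_odd hj] at h
    -- Moving every head part to sign `0` gives the sign-`0` part of the norm of `z`, which is zero.
    have h0 : ∑ g : ZMod p, shift (-g) (headPart g z) = 0 := by
      simp only [headPart_shift, add_neg_cancel]
      rw [← map_sum, Fintype.sum_equiv (Equiv.neg (ZMod p)) (fun g => shift (-g) z)
        (fun g => shift g z) fun g => rfl, h, map_zero]
    have h1 : z = -∑ g : ZMod p, (shift (-g) (headPart g z) - headPart g z) := by
      rw [Finset.sum_sub_distrib, h0, sum_headPart hz]; simp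
    have h2 : z ∈ (chainsOn fun l => l.length = n + 1).map
        (shift (1 : ZMod p) - LinearMap.id) := by
      rw [h1]
      exact Submodule.neg_mem _ (Submodule.sum_mem _ fun g _ =>
        shift_sub_self_mem _ (headPart_mem_length g hz))
    obtain ⟨w, hw, hwz⟩ := h2
    exact ⟨w, hw, by rw [alternatingOp_even hj', ← hwz]; rfl⟩

/-- The chains of the minimal resolution, realized with one new level in each step. -/
noncomputable def resolutionChain : ℕ → Chains p
  | 0 => single [(0, 0)] 1
  | j + 1 => prepend (j + 1, 0) (alternatingOp j (resolutionChain j))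

/-- The new vertex acts as a cone apex over a cycle: consecutive operators compose to zero, and in
degree 0 `alternatingOp_nil` applies. -/
lemma boundary_resolutionChain (j : ℕ) :
    boundary (resolutionChain (p := p) (j + 1)) = alternatingOp j (resolutionChain j) := by
  have h : boundary (alternatingOp j (resolutionChain (p := p) j)) = 0 := by
    rw [map_alternatingOp fun g => boundary_shift g _]
    cases j with
    | zero => simpa [resolutionChain] using alternatingOp_nil (p := p) 0
    | succ j => rw [boundary_resolutionChain j, alternatingOp_alternatingOp]
  rw [resolutionChain, boundary_prepend, h, map_zero, sub_zero]

lemma resolutionChain_mem (j : ℕ) :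
    resolutionChain (p := p) j ∈ chainsOn fun l => l.length = j + 1 ∧ IsSimplex (j + 1) l := by
  induction j with
  | zero => exact single_mem_chainsOn ⟨rfl, by simp [IsSimplex]⟩
  | succ j ih =>
    have h := alternatingOp_mem (P := fun l => l.length = j + 1 ∧ IsSimplex (j + 1) l)
      (fun g l hl => ⟨by simpa using hl.1, hl.2.map g⟩) j ih
    refine map_mem_of_chainsOn (fun l hl => ?_) h
    rw [prepend_single]
    refine single_mem_chainsOn ⟨by simp [hl.1], ?_, ?_⟩
    · exact List.pairwise_cons.2 ⟨fun v hv => hl.2.2 v hv, hl.2.1⟩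
    · intro v hv
      rcases List.mem_cons.1 hv with rfl | hv
      · exact Nat.lt_succ_self _
      · exact (hl.2.2 v hv).trans (Nat.lt_succ_self _)


/-- The `ℤ/p`-Tucker lemma. -/
theorem IsLabelling.le {N M : ℕ} {lam : List (ℕ × ZMod p) → ℕ × ZMod p}
    (h : IsLabelling N M lam) : N ≤ M := by
  by_contra! hMN
  obtain ⟨d, rfl⟩ : ∃ d, N = d + 1 := ⟨N - 1, by omega⟩
  have hx : ∀ j ≤ d, resolutionChain (p := p) j ∈
      chainsOn fun l => l.length = j + 1 ∧ IsSimplex (d + 1) l := fun j hj =>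
    chainsOn_mono (fun l hl => ⟨hl.1, hl.2.1, fun v hv => (hl.2.2 v hv).trans_le (by omega)⟩)
      (resolutionChain_mem j)
  have hy : ∀ j < d, boundary (labelMap lam (j + 2) (resolutionChain (j + 1))) =
      alternatingOp j (labelMap lam (j + 1) (resolutionChain j)) := fun j hj => by
    rw [h.boundary_labelMap (j + 1) (hx (j + 1) hj), boundary_resolutionChain,
      map_alternatingOp fun g => h.labelMap_shift (j + 1) g (hx j hj.le)]
  -- A simplex of length `d + 1` needs that many distinct levels below `M ≤ d`.
  have htop : labelMap lam (d + 1) (resolutionChain d) = 0 := by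
    have h1 := labelMap_mem_length lam (d + 1) (resolutionChain d)
    have h2 : labelMap lam (d + 1) (resolutionChain d) ∈ chainsOn (IsSimplex M) :=
      map_mem_of_chainsOn (fun l hl => h.labelMap_single_mem d hl.2 hl.1) (hx d le_rfl)
    by_contra h0
    obtain ⟨l, hl⟩ := Finsupp.support_nonempty_iff.2 h0
    have h3 : l.length = d + 1 := (Finsupp.mem_supported _ _).1 h1 hl
    have h4 : IsSimplex M l := (Finsupp.mem_supported _ _).1 h2 hl
    have := h4.length_le
    omega
  -- Descending induction on `j`: the boundary of the formula in degree `j + 1`, with period two,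
  -- shows that `alternatingOp j` kills the image minus `boundary w'`; exactness supplies `w''`.
  have key : ∀ i ≤ d, ∀ j, i + j = d → ∃ w, ∃ w' ∈ chainsOn fun l => l.length = j + 1,
      labelMap lam (j + 1) (resolutionChain j) = boundary w + alternatingOp (j + 1) w' := by
    intro i
    induction i with
    | zero =>
      rintro - j hj
      obtain rfl : j = d := by omega
      exact ⟨0, 0, Submodule.zero_mem _, by simp [htop]⟩
    | succ i ih =>
      intro hi j hj
      obtain ⟨w, w', hw', hw⟩ := ih (by omega) (j + 1) (by omega)
      have h1 := hy j (by omega)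
      rw [hw, map_add, boundary_boundary, zero_add, alternatingOp_add_two,
        map_alternatingOp fun g => boundary_shift g _] at h1
      have h2 : labelMap lam (j + 1) (resolutionChain j) - boundary w' ∈
          chainsOn fun l => l.length = j + 1 :=
        Submodule.sub_mem _ (labelMap_mem_length lam _ _) (boundary_mem_length hw')
      obtain ⟨w'', hw'', h3⟩ := exists_alternatingOp_eq j h2 (by rw [map_sub, h1, sub_self])
      exact ⟨w', w'', hw'', by rw [h3]; abel⟩
  obtain ⟨w, w', hw', hw⟩ := key d le_rfl 0 (by omega)
  have h1 := congrArg boundary hw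
  rw [h.boundary_labelMap 0 (hx 0 (Nat.zero_le _)), map_add, boundary_boundary, zero_add,
    map_alternatingOp fun g => boundary_shift g _] at h1
  -- `boundary w'` is a multiple of the empty list, which the norm kills, whereas the image of the
  -- initial vertex has boundary exactly the empty list.
  have h2 : alternatingOp 1 (boundary w') = 0 :=
    eqOn_chainsOn (f := alternatingOp 1) (g := 0) (fun l hl => by
      rw [List.length_eq_zero_iff.1 hl, alternatingOp_nil]; simp) (boundary_mem_length hw')
  rw [zero_add, h2] at h1
  simp [resolutionChain, labelMap] at h1

end Prime

end ZpTucker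

/-! ### Monochromatic `S`-disjoint families -/

namespace KneserMultiplicity

open Finset

/-! ### Set-valued form of the Tucker lemma -/

section Sign

variable {p : ℕ}

/-- Translation of the second coordinates. -/
def translate {T : Type*} [DecidableEq T] (g : ZMod p) (Q : Finset (T × ZMod p)) :
    Finset (T × ZMod p) :=
  Q.image fun v => (v.1, v.2 + g)

lemma mk_mem_translate {T : Type*} [DecidableEq T] {g : ZMod p} {Q : Finset (T × ZMod p)}
    {t : T} {h : ZMod p} : (t, h) ∈ translate g Q ↔ (t, h - g) ∈ Q := by
  simp only [translate, mem_image, Prod.mk.injEq]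
  constructor
  · rintro ⟨v, hv, rfl, rfl⟩
    simpa using hv
  · exact fun hQ => ⟨_, hQ, rfl, by simp⟩

variable [Fact p.Prime]

/-- Take the average of a nonempty fibre: its size lies strictly between 0 and `p`, so it is
invertible. The fibre is chosen from the set of nonempty fibres alone, which translation preserves.
-/
lemma exists_equivariant_sign (T : Type*) [DecidableEq T] :
    ∃ σ : Finset (T × ZMod p) → ZMod p, ∀ Q g, Q.Nonempty →
      (∀ t, #{h : ZMod p | (t, h) ∈ Q} < p) → σ (translate g Q) = σ Q + g := by
  rcases isEmpty_or_nonempty T with hT | hT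
  · exact ⟨fun _ => 0, fun Q g hQ => (hT.false hQ.choose.1).elim⟩
  let F : Finset (T × ZMod p) → T → Finset (ZMod p) := fun Q t => {h : ZMod p | (t, h) ∈ Q}
  let τ : Finset (T × ZMod p) → T := fun Q => Classical.epsilon fun t => (F Q t).Nonempty
  refine ⟨fun Q => (#(F Q (τ Q)) : ZMod p)⁻¹ * ∑ h ∈ F Q (τ Q), h, fun Q g hQ hcard => ?_⟩
  have hF : ∀ t, F (translate g Q) t = (F Q t).image (· + g) := fun t => by
    ext h
    simp only [F, mem_filter, mem_univ, true_and, mk_mem_translate, mem_image]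
    exact ⟨fun hh => ⟨_, hh, by simp⟩, by rintro ⟨x, hx, rfl⟩; simpa using hx⟩
  have hτ : τ (translate g Q) = τ Q := by
    simp only [τ, hF, image_nonempty]
  have hne : (F Q (τ Q)).Nonempty := by
    obtain ⟨⟨t, h⟩, hth⟩ := hQ
    exact Classical.epsilon_spec (p := fun t => (F Q t).Nonempty) ⟨t, h, by simpa [F] using hth⟩
  have h0 : (#(F Q (τ Q)) : ZMod p) ≠ 0 := fun h =>
    absurd (Nat.le_of_dvd hne.card_pos ((ZMod.natCast_eq_zero_iff _ _).1 h))
      (not_le.2 (hcard (τ Q)))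
  have hinj : Function.Injective (· + g : ZMod p → ZMod p) := add_left_injective g
  simp only [hτ, hF, card_image_of_injective _ hinj, sum_image hinj.injOn, sum_add_distrib,
    sum_const, nsmul_eq_mul]
  field_simp

/-- A form of the `ℤ/p`-Tucker lemma: a bound for two monotone equivariant families of sets, where
the second one takes over as soon as it is nonempty. -/
lemma le_of_monotone_equivariant {T U : Type*} [DecidableEq T] [DecidableEq U] {N K L : ℕ}
    (A : List (ℕ × ZMod p) → Finset (T × ZMod p)) (J : List (ℕ × ZMod p) → Finset (U × ZMod p))
    (hAmono : ∀ a b, a.Sublist b → A a ⊆ A b) (hJmono : ∀ a b, a.Sublist b → J a ⊆ J b)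
    (hAmap : ∀ g a, A (a.map fun v => (v.1, v.2 + g)) = translate g (A a))
    (hJmap : ∀ g a, J (a.map fun v => (v.1, v.2 + g)) = translate g (J a))
    (hA0 : ∀ a, ZpTucker.IsSimplex N a → a ≠ [] → (A a).Nonempty)
    (hAcard : ∀ a, ZpTucker.IsSimplex N a → ∀ t, #{h : ZMod p | (t, h) ∈ A a} < p)
    (hJcard : ∀ a, ZpTucker.IsSimplex N a → ∀ t, #{h : ZMod p | (t, h) ∈ J a} < p)
    (hK : ∀ a, ZpTucker.IsSimplex N a → J a = ∅ → #(A a) ≤ K)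
    (hL : ∀ a, ZpTucker.IsSimplex N a → #(J a) ≤ L) : N ≤ K + L := by
  obtain ⟨σ, hσ⟩ := exists_equivariant_sign (p := p) T
  obtain ⟨ρ, hρ⟩ := exists_equivariant_sign (p := p) U
  -- Levels start at 0, hence the `- 1`; the levels of `J` lie above those of `A`. By monotonicity,
  -- equal cardinalities force equal sets and hence equal signs.
  let lam : List (ℕ × ZMod p) → ℕ × ZMod p := fun a =>
    if J a = ∅ then (#(A a) - 1, σ (A a)) else (K + #(J a) - 1, ρ (J a))
  have hempty : ∀ a, J a = ∅ → lam a = (#(A a) - 1, σ (A a)) := fun a h => if_pos h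
  have hfull : ∀ a, J a ≠ ∅ → lam a = (K + #(J a) - 1, ρ (J a)) := fun a h => if_neg h
  have hcardA : ∀ g a, #(translate g (A a)) = #(A a) := fun g a =>
    card_image_of_injective _ fun v w h => by simpa [Prod.ext_iff] using h
  have hcardJ : ∀ g a, #(translate g (J a)) = #(J a) := fun g a =>
    card_image_of_injective _ fun v w h => by simpa [Prod.ext_iff] using h
  have hlam : ZpTucker.IsLabelling N (K + L) lam := by
    refine ⟨fun a ha ha0 => ?_, fun g a ha ha0 => ?_, fun a b hb ha0 hab => ?_⟩
    · by_cases hJ : J a = ∅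
      · rw [hempty a hJ]
        have := hK a ha hJ
        have := (hA0 a ha ha0).card_pos
        dsimp only
        omega
      · rw [hfull a hJ]
        have := hL a ha
        have := (nonempty_iff_ne_empty.2 hJ).card_pos
        dsimp only
        omega
    · by_cases hJ : J a = ∅
      · have hJ' : J (a.map fun v => (v.1, v.2 + g)) = ∅ := by rw [hJmap, hJ]; rfl
        rw [hempty _ hJ', hempty a hJ, hAmap, hcardA, hσ _ _ (hA0 a ha ha0) (hAcard a ha)]
      · have hJ' : J (a.map fun v => (v.1, v.2 + g)) ≠ ∅ := by
          rw [hJmap, translate, Ne, image_eq_empty]; exact hJ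
        rw [hfull _ hJ', hfull a hJ, hJmap, hcardJ,
          hρ _ _ (nonempty_iff_ne_empty.2 hJ) (hJcard a ha)]
    · have ha := hb.sublist hab
      have hApos := (hA0 a ha ha0).card_pos
      by_cases hJb : J b = ∅
      · have hJa : J a = ∅ := subset_empty.1 (hJb ▸ hJmono a b hab)
        rw [hempty a hJa, hempty b hJb]
        rcases (hAmono a b hab).eq_or_ssubset with h | h
        · right; rw [h]
        · left
          have := card_lt_card h
          dsimp only
          omega
      · have hJpos := (nonempty_iff_ne_empty.2 hJb).card_pos
        rw [hfull b hJb]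
        by_cases hJa : J a = ∅
        · rw [hempty a hJa]
          left
          have := hK a ha hJa
          dsimp only
          omega
        · rw [hfull a hJa]
          have hJpos' := (nonempty_iff_ne_empty.2 hJa).card_pos
          rcases (hJmono a b hab).eq_or_ssubset with h | h
          · right; rw [h]
          · left
            have := card_lt_card h
            dsimp only
            omega
  exact hlam.le

end Sign

/-! ### Lower bound: products and primes -/

/-- A family of `k`-sets of the same color such that every `i` lies in at most `S i` of them. -/
structure IsMonochromaticFamily {α ι : Type} [DecidableEq α] [Fintype ι] (k : ℕ) (S : α → ℕ)
    (col : Finset α → ℕ) (B : ι → Finset α) : Prop where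
  card : ∀ j, #(B j) = k
  col_eq : ∀ j j', col (B j) = col (B j')
  le : ∀ i, #{j | i ∈ B j} ≤ S i

lemma IsMonochromaticFamily.comp_equiv {α ι κ : Type} [DecidableEq α] [Fintype ι] [Fintype κ]
    {k : ℕ} {S : α → ℕ} {col : Finset α → ℕ} {B : ι → Finset α}
    (h : IsMonochromaticFamily k S col B) (e : κ ≃ ι) :
    IsMonochromaticFamily k S col (B ∘ e) := by
  refine ⟨fun j => h.card _, fun j j' => h.col_eq _ _, fun i => le_trans ?_ (h.le i)⟩
  exact card_le_card_of_injOn e (fun j hj => by simpa using hj) e.injective.injOn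

/-- The lower bound for `r`: if all multiplicities are at most `r` and their sum is large, then
every coloring of the `k`-sets has a monochromatic `S`-disjoint family of `r` sets. -/
def ForcesMonochromatic (r : ℕ) : Prop :=
  ∀ (α : Type) [Fintype α] [DecidableEq α] (k c : ℕ) (S : α → ℕ) (col : Finset α → ℕ),
    (∀ A, #A = k → col A < c) → (∀ i, S i ≤ r) → r * k + (r - 1) * c + 1 ≤ ∑ i, S i + r →
      ∃ B : Fin r → Finset α, IsMonochromaticFamily k S col B

lemma ForcesMonochromatic.zero : ForcesMonochromatic 0 := fun _ _ _ _ _ _ _ _ _ _ =>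
  ⟨Fin.elim0, fun j => j.elim0, fun j => j.elim0, fun _ => by simp⟩

lemma ForcesMonochromatic.one : ForcesMonochromatic 1 := by
  intro α _ _ k c S col _ hS hsum
  have h1 : ∑ i, S i ≤ #{i | S i = 1} := by
    rw [card_filter]
    refine sum_le_sum fun i _ => ?_
    have := hS i
    split_ifs <;> omega
  obtain ⟨B, hB, hBk⟩ := exists_subset_card_eq (s := ({i | S i = 1} : Finset α)) (n := k) (by omega)
  refine ⟨fun _ => B, fun _ => hBk, fun _ _ => rfl, fun i => ?_⟩
  by_cases hi : i ∈ B
  · have : S i = 1 := by simpa using hB hi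
    simp [this, hi]
  · simp [hi]

lemma exists_bounded_sum_eq (m b s : ℕ) (h : s ≤ m * b) :
    ∃ f : Fin b → ℕ, (∀ l, f l ≤ m) ∧ ∑ l, f l = s := by
  induction b generalizing s with
  | zero => exact ⟨fun _ => 0, fun _ => Nat.zero_le _, by simp at h; simp [h]⟩
  | succ b ih =>
    obtain ⟨f, hf, hfs⟩ := ih (s - min m s) (by rw [Nat.mul_succ] at h; omega)
    refine ⟨Fin.cons (min m s) f, fun l => ?_, ?_⟩
    · refine Fin.cases ?_ (fun l => ?_) l
      · simp
      · simpa using hf l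
    · rw [Fin.sum_univ_succ]
      simp only [Fin.cons_zero, Fin.cons_succ, hfs]
      omega

/-- Spread each multiplicity over `r₂` copies. A set of `N` copies forces a monochromatic family of
`r₂` sets and inherits its colour; `r₁` such sets of one colour combine to `r₁ * r₂` sets. -/
lemma ForcesMonochromatic.mul {r₁ r₂ : ℕ} (h₁ : ForcesMonochromatic r₁)
    (h₂ : ForcesMonochromatic r₂) : ForcesMonochromatic (r₁ * r₂) := by
  rcases Nat.eq_zero_or_pos r₁ with rfl | hr₁
  · rw [zero_mul]; exact .zero
  rcases Nat.eq_zero_or_pos r₂ with rfl | hr₂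
  · rw [mul_zero]; exact .zero
  obtain ⟨a, rfl⟩ : ∃ a, r₁ = a + 1 := ⟨r₁ - 1, by omega⟩
  obtain ⟨b, rfl⟩ : ∃ b, r₂ = b + 1 := ⟨r₂ - 1, by omega⟩
  intro α _ _ k c S col hcol hS hsum
  -- The threshold for `r₂`, attained with equality; for `k = 0` it is a natural number because the
  -- colour of `∅` forces `c > 0`.
  obtain ⟨N, hN⟩ : ∃ N, (b + 1) * k + b * c + 1 = N + (b + 1) := by
    have : b + 1 ≤ (b + 1) * k + b * c + 1 := by
      rcases Nat.eq_zero_or_pos k with rfl | hk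
      · have := Nat.le_mul_of_pos_right b (Nat.zero_lt_of_lt (hcol ∅ (by simp)))
        omega
      · have := Nat.le_mul_of_pos_right (b + 1) hk
        omega
    exact ⟨_, (Nat.sub_add_cancel this).symm⟩
  choose T hT hTS using fun i => exists_bounded_sum_eq (a + 1) (b + 1) (S i) (hS i)
  -- Guarding by `#D = N` inside the existential lets `choose` give a total colouring.
  have inner : ∀ D : Finset (α × Fin (b + 1)), ∃ t, #D = N → t < c ∧
      ∃ B : Fin (b + 1) → Finset α,
        IsMonochromaticFamily k (fun i => #{l | (i, l) ∈ D}) col B ∧ ∀ l, col (B l) = t := by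
    intro D
    by_cases hD : #D = N
    · have hDsum : ∑ i, #{l | (i, l) ∈ D} = N := by
        simp_rw [card_filter]
        rw [← hD, ← Fintype.sum_prod_type' fun i l => if (i, l) ∈ D then 1 else 0]
        simp
      obtain ⟨B, hB⟩ := h₂ α k c (fun i => #{l | (i, l) ∈ D}) col hcol
        (fun i => (card_le_univ _).trans (by simp)) (by
          rw [hDsum, ← hN]; simp)
      exact ⟨col (B 0), fun _ => ⟨hcol _ (hB.card 0), B, hB, fun l => hB.col_eq l 0⟩⟩
    · exact ⟨0, fun h => absurd h hD⟩
  choose col' hcol' using inner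
  have hTsum : ∑ x : α × Fin (b + 1), T x.1 x.2 = ∑ i, S i := by
    rw [Fintype.sum_prod_type' T]
    exact sum_congr rfl fun i _ => hTS i
  obtain ⟨D, hD⟩ := h₁ (α × Fin (b + 1)) N c (fun x => T x.1 x.2) col'
    (fun D hD => (hcol' D hD).1) (fun x => hT x.1 x.2) (by
      rw [hTsum]
      have e1 : (a + 1) * (b + 1) - 1 = a * b + a + b := by
        have : (a + 1) * (b + 1) = a * b + a + b + 1 := by ring
        omega
      rw [e1] at hsum
      simp only [Nat.add_sub_cancel]
      nlinarith)
  choose B hB hBcol using fun j => (hcol' (D j) (hD.card j)).2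
  have hfam : IsMonochromaticFamily k S col fun x : Fin (a + 1) × Fin (b + 1) => B x.1 x.2 := by
    refine ⟨fun x => (hB x.1).card x.2, fun x y => ?_, fun i => ?_⟩
    · rw [hBcol, hBcol, hD.col_eq x.1 y.1]
    · calc #{x : Fin (a + 1) × Fin (b + 1) | i ∈ B x.1 x.2}
          = ∑ m, #{l | i ∈ B m l} := by
            simp_rw [card_filter]
            exact Fintype.sum_prod_type' fun m l => if i ∈ B m l then 1 else 0
        _ ≤ ∑ m, #{l | (i, l) ∈ D m} := sum_le_sum fun m _ => (hB m).le i
        _ = ∑ l, #{m | (i, l) ∈ D m} := by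
            simp_rw [card_filter]
            exact sum_comm
        _ ≤ ∑ l, T i l := sum_le_sum fun l _ => hD.le (i, l)
        _ = S i := hTS i
  exact ⟨_, hfam.comp_equiv finProdFinEquiv.symm⟩

lemma ForcesMonochromatic.prime {p : ℕ} (hp : p.Prime) : ForcesMonochromatic p := by
  have : Fact p.Prime := ⟨hp⟩
  intro α _ _ k c S col hcol hS hsum
  by_contra hno
  set F : Finset α := {i | S i = p} with hF
  have hFk : #F < k := by
    by_contra! hk
    obtain ⟨B, hB, hBk⟩ := exists_subset_card_eq hk
    refine hno ⟨fun _ => B, fun _ => hBk, fun _ _ => rfl, fun i => ?_⟩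
    by_cases hi : i ∈ B
    · have : S i = p := by simpa [hF] using hB hi
      simp [this, hi]
    · simp [hi]
  let S' : α → ℕ := fun i => if S i = p then 0 else S i
  have hS' : ∀ i, S' i < p := fun i => by
    simp only [S']
    split_ifs with h
    · exact hp.pos
    · exact lt_of_le_of_ne (hS i) h
  set N := ∑ i, S' i with hN
  have hSN : ∑ i, S i = N + #F * p := by
    rw [hN, hF, card_filter, sum_mul, ← sum_add_distrib]
    refine sum_congr rfl fun i _ => ?_
    simp only [S']
    split_ifs <;> simp [*]
  let e : (Σ i, Fin (S' i)) ≃ Fin N := Fintype.equivFinOfCardEq (by simp [hN])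
  let A : List (ℕ × ZMod p) → Finset (α × ZMod p) := fun l =>
    {x | ∃ y : Fin (S' x.1), ((e ⟨x.1, y⟩ : ℕ), x.2) ∈ l}
  let J : List (ℕ × ZMod p) → Finset (ℕ × ZMod p) := fun l =>
    -- Pairs of a colour and a sign such that a `k`-set of that colour fits into `F` and the
    -- elements carrying that sign.
    {x ∈ range c ×ˢ univ | ∃ B, #B = k ∧ col B = x.1 ∧ ∀ i ∈ B, i ∈ F ∨ (i, x.2) ∈ A l}
  have memA : ∀ l i g, (i, g) ∈ A l ↔ ∃ y : Fin (S' i), ((e ⟨i, y⟩ : ℕ), g) ∈ l :=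
    fun l i g => by simp [A]
  have memJ : ∀ l t g, (t, g) ∈ J l ↔
      t < c ∧ ∃ B, #B = k ∧ col B = t ∧ ∀ i ∈ B, i ∈ F ∨ (i, g) ∈ A l :=
    fun l t g => by simp [J]
  have mapmem : ∀ (l : List (ℕ × ZMod p)) (m : ℕ) (h g : ZMod p),
      (m, h) ∈ l.map (fun v => (v.1, v.2 + g)) ↔ (m, h - g) ∈ l := fun l m h g => by
    simp only [List.mem_map, Prod.mk.injEq]
    exact ⟨by rintro ⟨v, hv, rfl, rfl⟩; simpa using hv, fun hl => ⟨_, hl, rfl, by simp⟩⟩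
  have hAmap : ∀ g a, A (a.map fun v => (v.1, v.2 + g)) = translate g (A a) := fun g a => by
    ext ⟨i, h⟩
    simp only [memA, mk_mem_translate, mapmem]
  have hAfib : ∀ a, ZpTucker.IsSimplex N a → ∀ i, #{h : ZMod p | (i, h) ∈ A a} ≤ S' i := by
    intro a ha i
    have hu : ∀ m g h, (m, g) ∈ a → (m, h) ∈ a → g = h := fun m g h hg hh => by
      simpa using List.inj_on_of_nodup_map ha.nodup hg hh rfl
    refine le_of_le_of_eq (card_le_card_of_forall_subsingleton
      (t := (univ : Finset (Fin (S' i)))) (fun h y => ((e ⟨i, y⟩ : ℕ), h) ∈ a) ?_ ?_) (by simp)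
    · intro h hh
      obtain ⟨y, hy⟩ := (memA _ _ _).1 (mem_filter.1 hh).2
      exact ⟨y, mem_univ _, hy⟩
    · rintro y - g hg h hh
      exact hu _ _ _ hg.2 hh.2
  have hJfib : ∀ a, ZpTucker.IsSimplex N a → ∀ t, #{h : ZMod p | (t, h) ∈ J a} < p := by
    intro a ha t
    -- A colour captured by all `p` signs would provide one set per sign, a forbidden family.
    by_contra! hle
    have huniv : ({h : ZMod p | (t, h) ∈ J a} : Finset (ZMod p)) = univ :=
      (card_eq_iff_eq_univ _).1 (le_antisymm (card_le_univ _) (by rwa [ZMod.card]))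
    have hall : ∀ h, (t, h) ∈ J a := fun h => by
      have := mem_univ h
      rw [← huniv] at this
      simpa using this
    choose B hBk hBt hB using fun h => ((memJ _ _ _).1 (hall h)).2
    have hfam : IsMonochromaticFamily k S col B := by
      refine ⟨hBk, fun j j' => by rw [hBt, hBt], fun i => ?_⟩
      by_cases hi : S i = p
      · exact (card_le_univ _).trans (by rw [ZMod.card, hi])
      · refine le_trans (card_le_card fun h hh => ?_) ((hAfib a ha i).trans_eq (if_neg hi))
        rw [mem_filter] at hh ⊢
        exact ⟨mem_univ _, (hB h i hh.2).resolve_left (by simpa [hF] using hi)⟩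
    exact hno ⟨_, hfam.comp_equiv (Fintype.equivOfCardEq (by simp [ZMod.card]))⟩
  -- If no colour is captured, `F` and the elements of any one sign number at most `k - 1` together;
  -- each colour is captured by at most `p - 1` signs.
  have hle : N ≤ (k - 1 - #F) * p + (p - 1) * c := by
    refine le_of_monotone_equivariant A J ?_ ?_ hAmap ?_ ?_ ?_ hJfib ?_ ?_
    · rintro a b hab ⟨i, g⟩ h
      obtain ⟨y, hy⟩ := (memA _ _ _).1 h
      exact (memA _ _ _).2 ⟨y, hab.subset hy⟩
    · rintro a b hab ⟨t, g⟩ h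
      obtain ⟨ht, B, hBk, hBt, hB⟩ := (memJ _ _ _).1 h
      refine (memJ _ _ _).2 ⟨ht, B, hBk, hBt, fun i hi => (hB i hi).imp_right fun h => ?_⟩
      obtain ⟨y, hy⟩ := (memA _ _ _).1 h
      exact (memA _ _ _).2 ⟨y, hab.subset hy⟩
    · intro g a
      ext ⟨t, h⟩
      simp only [memJ, mk_mem_translate, hAmap]
    · intro a ha ha0
      obtain ⟨⟨m, g⟩, hv⟩ := List.exists_mem_of_ne_nil a ha0
      refine ⟨((e.symm ⟨m, ha.2 _ hv⟩).1, g), (memA _ _ _).2 ⟨(e.symm ⟨m, ha.2 _ hv⟩).2, ?_⟩⟩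
      simpa using hv
    · exact fun a ha i => (hAfib a ha i).trans_lt (hS' i)
    · intro a ha hJ
      refine (card_le_mul_card_image (f := Prod.snd) (A a) (k - 1 - #F) fun g _ => ?_).trans
        (Nat.mul_le_mul_left _ ((card_le_univ _).trans_eq (ZMod.card p)))
      have h1 : #{x ∈ A a | x.2 = g} ≤ #{i | (i, g) ∈ A a} := by
        refine card_le_card_of_injOn Prod.fst ?_ ?_
        · rintro ⟨i, h⟩ hx
          obtain ⟨hx, rfl⟩ := mem_filter.1 hx
          simpa using hx
        · rintro ⟨i, h⟩ hx ⟨i', h'⟩ hx' hii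
          have e1 := (mem_filter.1 hx).2
          have e2 := (mem_filter.1 hx').2
          exact Prod.ext hii (e1.trans e2.symm)
      have hdisj : Disjoint F ({i | (i, g) ∈ A a} : Finset α) := by
        rw [disjoint_left]
        intro i hi hi'
        obtain ⟨y, -⟩ := (memA _ _ _).1 (mem_filter.1 hi').2
        have h0 : S' i = 0 := if_pos (by simpa [hF] using hi)
        exact (Fin.cast h0 y).elim0
      have h2 : #(F ∪ ({i | (i, g) ∈ A a} : Finset α)) < k := by
        by_contra! hk
        obtain ⟨B, hB, hBk⟩ := exists_subset_card_eq hk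
        have : (col B, g) ∈ J a := (memJ _ _ _).2 ⟨hcol B hBk, B, hBk, rfl, fun i hi => by
          simpa using hB hi⟩
        simp [hJ] at this
      rw [card_union_of_disjoint hdisj] at h2
      omega
    · intro a ha
      have h1 : #((J a).image Prod.fst) ≤ c := by
        refine (card_le_card (t := range c) fun t ht => ?_).trans_eq (card_range c)
        obtain ⟨⟨t, g⟩, hx, rfl⟩ := mem_image.1 ht
        exact mem_range.2 ((memJ _ _ _).1 hx).1
      refine (card_le_mul_card_image (f := Prod.fst) (J a) (p - 1) fun t _ => ?_).trans
        (Nat.mul_le_mul_left _ h1)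
      refine le_trans ?_ (Nat.le_sub_one_of_lt (hJfib a ha t))
      refine card_le_card_of_injOn Prod.snd ?_ ?_
      · rintro ⟨i, h⟩ hx
        obtain ⟨hx, rfl⟩ := mem_filter.1 hx
        simpa using hx
      · rintro ⟨i, h⟩ hx ⟨i', h'⟩ hx' hii
        have e1 := (mem_filter.1 hx).2
        have e2 := (mem_filter.1 hx').2
        exact Prod.ext (e1.trans e2.symm) hii
  obtain ⟨d, hd⟩ : ∃ d, k = #F + 1 + d := ⟨k - 1 - #F, by omega⟩
  have hd' : k - 1 - #F = d := by omega
  rw [hd'] at hle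
  rw [hSN, hd] at hsum
  nlinarith

theorem forcesMonochromatic (r : ℕ) : ForcesMonochromatic r :=
  Nat.recOnMul .zero .one (fun _ hp => .prime hp) (fun _ _ h₁ h₂ => h₁.mul h₂) r

/-! ### Proper colorings of Kneser hypergraphs -/

lemma sum_card_inter_le {n k s : ℕ} {S : Fin n → ℕ} (hS : ∀ i, S i = s)
    {e : Multiset (KSubset n k)} (he : IsSDisjoint S e) (D : Finset (Fin n)) :
    (e.map fun A => #(A.1 ∩ D)).sum ≤ #D * s := by
  have h : (e.map fun A => #(A.1 ∩ D)).sum = ∑ i ∈ D, e.countP fun A => i ∈ A.1 := by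
    clear he
    induction e using Multiset.induction_on with
    | empty => simp
    | cons A e ih =>
      simp only [Multiset.map_cons, Multiset.sum_cons, ih, Multiset.countP_cons, sum_add_distrib]
      rw [add_comm, ← card_filter, filter_mem_eq_inter, inter_comm]
  rw [h, ← smul_eq_mul]
  exact sum_le_card_nsmul _ _ _ fun i _ => (he i).trans_eq (hS i)

lemma colorable_of_lt {n k r s m : ℕ} {S : Fin n → ℕ} (hr : 2 ≤ r) (hk : 1 ≤ k)
    (hS : ∀ i, S i = s) (hs : s ∣ r - 1) (hm : n * s + r < r * k + (r - 1) * (m + 1) + 1) :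
    (kneserHypergraph r n k S).Colorable (m + 1) := by
  obtain ⟨q, hq⟩ := hs
  have hne : ∀ A : KSubset n k, A.1.Nonempty := fun A => card_pos.1 (by rw [A.2]; exact hk)
  refine ⟨fun A => ⟨min ((A.1.min' (hne A) : ℕ) / q) m, by omega⟩, fun e he => ?_⟩
  obtain ⟨hcard, hdisj⟩ := he
  by_contra! hmono
  obtain ⟨V, hV⟩ := Multiset.card_pos_iff_exists_mem.1 (by omega : 0 < e.card)
  have hcol : ∀ A ∈ e, min ((A.1.min' (hne A) : ℕ) / q) m = min ((V.1.min' (hne V) : ℕ) / q) m :=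
    fun A hA => congrArg Fin.val (hmono A hA V hV)
  have hsum := sum_card_inter_le hS hdisj
  have hlow : ∀ (D : Finset (Fin n)) (x : ℕ), (∀ A ∈ e, x ≤ #(A.1 ∩ D)) → r * x ≤ #D * s := by
    intro D x hx
    refine le_trans ?_ (hsum D)
    have := Multiset.card_nsmul_le_sum (s := e.map fun A => #(A.1 ∩ D)) (a := x)
      (fun y hy => by obtain ⟨A, hA, rfl⟩ := Multiset.mem_map.1 hy; exact hx A hA)
    simpa [hcard] using this
  have hinterval : ∀ (D : Finset (Fin n)) (x y : ℕ), (∀ i ∈ D, x ≤ (i : ℕ) ∧ (i : ℕ) < y) →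
      #D ≤ y - x := by
    intro D x y hD
    rw [← Nat.card_Ico, ← card_map Fin.valEmbedding]
    refine card_le_card fun i hi => ?_
    obtain ⟨j, hj, rfl⟩ := mem_map.1 hi
    exact mem_Ico.2 (hD j hj)
  have hq0 : 0 < q := Nat.pos_of_ne_zero fun h => by subst h; omega
  -- In a block colour, `r` minima share `q` elements, so `r ≤ q * s = r - 1`. In the last colour
  -- all sets avoid the first `m * q` elements, against `hm`.
  by_cases hVm : (V.1.min' (hne V) : ℕ) / q < m
  · set t := (V.1.min' (hne V) : ℕ) / q with ht
    have h1 := hlow ({i | (i : ℕ) / q = t} : Finset (Fin n)) 1 fun A hA => by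
      refine card_pos.2 ⟨A.1.min' (hne A), mem_inter.2 ⟨min'_mem _ _, ?_⟩⟩
      have := hcol A hA
      rw [mem_filter]
      exact ⟨mem_univ _, by omega⟩
    have h2 := hinterval ({i | (i : ℕ) / q = t} : Finset (Fin n)) (t * q) (t * q + q) fun i hi => by
      have h3 : (i : ℕ) / q = t := by simpa using hi
      rw [Nat.div_eq_iff hq0] at h3
      omega
    have h3 := Nat.mul_le_mul_right s (h2.trans_eq (Nat.add_sub_cancel_left _ _))
    rw [mul_comm q s] at h3
    omega
  · have h1 := hlow ({i | m * q ≤ (i : ℕ)} : Finset (Fin n)) k fun A hA => by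
      rw [inter_eq_left.2, A.2]
      intro i hi
      have h2 := hcol A hA
      have h3 : m ≤ (A.1.min' (hne A) : ℕ) / q := by omega
      have h4 : (A.1.min' (hne A) : ℕ) ≤ i := min'_le _ _ hi
      rw [mem_filter]
      exact ⟨mem_univ _, ((Nat.le_div_iff_mul_le hq0).1 h3).trans h4⟩
    have h2 := hinterval ({i | m * q ≤ (i : ℕ)} : Finset (Fin n)) (m * q) n fun i hi =>
      ⟨by simpa using hi, i.2⟩
    have h3 := h1.trans (Nat.mul_le_mul_right s h2)
    have h4 : 0 < r * k := Nat.mul_pos (by omega) hk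
    rcases Nat.le_total n (m * q) with h5 | h5
    · rw [Nat.sub_eq_zero_of_le h5, zero_mul] at h3
      omega
    · obtain ⟨d, rfl⟩ := Nat.exists_eq_add_of_le h5
      rw [Nat.add_sub_cancel_left] at h3
      have h6 : (m * q + d) * s = (r - 1) * m + d * s := by rw [hq]; ring
      rw [h6, Nat.mul_succ] at hm
      omega

lemma lt_of_colorable {n k r m : ℕ} {S : Fin n → ℕ} (hS : ∀ i, S i ≤ r)
    (h : (kneserHypergraph r n k S).Colorable m) :
    ∑ i, S i + r < r * k + (r - 1) * m + 1 := by
  by_contra! hle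
  obtain ⟨c, hc⟩ := h
  obtain ⟨B, hB⟩ := forcesMonochromatic r (Fin n) k m S
    (fun A => if hA : #A = k then c ⟨A, hA⟩ else 0) (fun A hA => by simp [hA]) hS hle
  obtain ⟨v, hv, w, hw, hvw⟩ := hc
    ((univ : Finset (Fin r)).val.map fun j => (⟨B j, hB.card j⟩ : KSubset n k))
    ⟨by simp, fun i => by
      rw [Multiset.countP_map]
      exact hB.le i⟩
  obtain ⟨j, -, rfl⟩ := Multiset.mem_map.1 hv
  obtain ⟨j', -, rfl⟩ := Multiset.mem_map.1 hw
  have := hB.col_eq j j'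
  simp only [hB.card, dite_true] at this
  exact hvw (Fin.ext this)

end KneserMultiplicity

theorem corollary3 (n k r s : ℕ) (S : Fin n → ℕ) (hr : 2 ≤ r) (hk : 1 ≤ k)
    (hS : ∀ i, S i = s) (hs : s ∣ r - 1) (hn : r * k ≤ n * s) :
    (kneserHypergraph r n k S).chromaticNumber =
      ((⌈((n : ℚ) * s - r * ((k : ℚ) - 1)) / ((r : ℚ) - 1)⌉₊ : ℕ) : ℕ∞) := by
  have hsr : s ≤ r := (Nat.le_of_dvd (by omega) hs).trans (Nat.sub_le r 1)
  have hcol : ∀ m, (kneserHypergraph r n k S).Colorable m ↔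
      ⌈((n : ℚ) * s - r * ((k : ℚ) - 1)) / ((r : ℚ) - 1)⌉₊ ≤ m := by
    intro m
    have hr' : (0 : ℚ) < (r : ℚ) - 1 := by
      have : (2 : ℚ) ≤ r := by exact_mod_cast hr
      linarith
    have hiff : ⌈((n : ℚ) * s - r * ((k : ℚ) - 1)) / ((r : ℚ) - 1)⌉₊ ≤ m ↔
        n * s + r < r * k + (r - 1) * m + 1 := by
      rw [Nat.ceil_le, div_le_iff₀ hr', Nat.lt_succ_iff, ← Nat.cast_le (α := ℚ)]
      push_cast [Nat.cast_sub (by omega : 1 ≤ r)]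
      constructor <;> intro h <;> linarith
    rw [hiff]
    constructor
    · intro h
      have := KneserMultiplicity.lt_of_colorable (fun i => (hS i).trans_le hsr) h
      simpa [hS] using this
    · intro h
      cases m with
      -- Zero colours are excluded by `hn`.
      | zero => rw [mul_zero] at h; omega
      | succ m => exact KneserMultiplicity.colorable_of_lt hr hk hS hs h
  refine le_antisymm (iInf₂_le _ ((hcol _).2 le_rfl)) (le_iInf₂ fun m hm => ?_)
  exact_mod_cast (hcol m).1 hm
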